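/- Let $N,T$ be nonnegative integers, and for integers $0\le S\le T$ let $\Omega(N,T,S)$ be the (finite, nonempty) set of families of $N$ non-intersecting lattice paths $\tau_1,\dots,\tau_N$, where $\tau_i$ goes from $(0,i-1)$ to $(T,S+i-1)$ by steps $\tau_i(s+1)-\tau_i(s)\in\{0,1\}$. For $0\le t\le T$ put $$\mathfrak X^{S,t}=\{x\in\mathbb Z:\ \max(0,t+S-T)\le x\le \min(t+N-1,S+N-1)\},$$ $$\mathcal X^{S,t}=\{(x_1,\dots,x_N)\in(\mathfrak X^{S,t})^N:\ x_1<\dots<x_N\},$$ and, for $Y=(y_1<\dots<y_N)\in\mathcal X^{S,t}$, let $\rho_{S,t}(Y)$ be the probability that $(\tau_1(t),\dots,\tau_N(t))=Y$ when $(\tau_1,\dots,\tau_N)$ is uniformly distributed on $\Omega(N,T,S)$. Write $(a)_k=a(a+1)\cdots(a+k-1)$. For $X=(x_1<\dots<x_N)\in\mathcal X^{S,t}$ define, if $y_i-x_i\in\{0,1\}$ for every $i$, $$P^{S,t}_{t+}(X,Y)=\frac{\prod_{i<j}(y_j-y_i)\prod_{i:\,y_i=x_i+1}(N+S-x_i-1)\prod_{i:\,y_i=x_i}(x_i+T-t-S)}{(T-t)_N\prod_{i<j}(x_j-x_i)},\quad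 Y\in\mathcal X^{S,t+1}\quad (t<T),$$ $$P^{S,t}_{S+}(X,Y)=\frac{\prod_{i<j}(y_j-y_i)\prod_{i:\,y_i=x_i+1}(N+t-x_i-1)\prod_{i:\,y_i=x_i}(x_i+T-t-S)}{(T-S)_N\prod_{i<j}(x_j-x_i)},\quad Y\in\mathcal X^{S+1,t}\quad (S<T),$$ and, if $y_i-x_i\in\{-1,0\}$ for every $i$, $$P^{S,t}_{t-}(X,Y)=\frac{\prod_{i<j}(y_j-y_i)\prod_{i:\,y_i=x_i-1}x_i\prod_{i:\,y_i=x_i}(t+N-1-x_i)}{(t)_N\prod_{i<j}(x_j-x_i)},\quad Y\in\mathcal X^{S,t-1}\quad (t>0),$$ $$P^{S,t}_{S-}(X,Y)=\frac{\prod_{i<j}(y_j-y_i)\prod_{i:\,y_i=x_i-1}x_i\prod_{i:\,y_i=x_i}(S+N-1-x_i)}{(S)_N\prod_{i<j}(x_j-x_i)},\quad Y\in\mathcal X^{S-1,t}\quad (S>0);$$ in all other cases the matrix entry is $0$. Then, for all integers $0\le S\le T$ and $0\le t\le T$, each of these four matrices, whenever it is defined (that is, for $t<T$, $S<T$, $t>0$,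 $S>0$ respectively), is stochastic: its entries are nonnegative, and $$\sum_{Y\in\mathcal X^{S,t\pm1}}P^{S,t}_{t\pm}(X,Y)=1,\qquad \sum_{Y\in\mathcal X^{S\pm1,t}}P^{S,t}_{S\pm}(X,Y)=1\qquad\text{for every }X\in\mathcal X^{S,t}.$$ Moreover, $$\rho_{S,t\pm1}(Y)=\sum_{X\in\mathcal X^{S,t}}P^{S,t}_{t\pm}(X,Y)\,\rho_{S,t}(X)\quad\text{for every }Y\in\mathcal X^{S,t\pm1},$$ $$\rho_{S\pm1,t}(Y)=\sum_{X\in\mathcal X^{S,t}}P^{S,t}_{S\pm}(X,Y)\,\rho_{S,t}(X)\quad\text{for every }Y\in\mathcal X^{S\pm1,t}.$$ -/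

import Mathlib

noncomputable section

namespace LozengePaths

/-- Families of `N` integer-valued sequences `τ i 0, …, τ i T`, one for each `i`. -/
abbrev PathFamily (N T : ℕ) : Type := Fin N → Fin (T + 1) → ℤ

/-- The set of families of `N` non-intersecting paths made of segments of slopes `0` and `1`, the
`i`-th of which (numbered from `0`) goes from `(0, i)` to `(T, S + i)`. Two such paths intersect if
and only if they have a common vertex. -/
def Omega (N T : ℕ) (S : ℤ) : Set (PathFamily N T) :=
  {τ | (∀ i, τ i 0 = ((i : ℕ) : ℤ)) ∧
    (∀ i, τ i (Fin.last T) = S + ((i : ℕ) : ℤ)) ∧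
    (∀ i, ∀ k : Fin T, τ i k.succ - τ i k.castSucc = 0 ∨ τ i k.succ - τ i k.castSucc = 1) ∧
    (∀ i j, i ≠ j → ∀ k, τ i k ≠ τ j k)}

/-- The uniform probability measure on `Omega N T S`. -/
def mu (N T : ℕ) (S : ℤ) : MeasureTheory.Measure (PathFamily N T) :=
  ProbabilityTheory.uniformOn (Omega N T S)

/-- The section of the hexagon by the vertical line with coordinate `t`. -/
def sectionPoints (N T : ℕ) (S t : ℤ) : Finset ℤ :=
  Finset.Icc (max 0 (t + S - T)) (min (t + N - 1) (S + N - 1))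

/-- The increasing `N`-tuples of points of the section with coordinate `t`. -/
def configs (N T : ℕ) (S t : ℤ) : Finset (Fin N → ℤ) :=
  {x ∈ Fintype.piFinset fun _ : Fin N => sectionPoints N T S t | ∀ i j, i < j → x i < x j}

/-- The probability that a uniformly distributed family of paths passes, at the coordinate `t`,
through the points of the configuration `Y`. -/
def rho (N T : ℕ) (S t : ℤ) (Y : configs N T S t) : ℝ :=
  (mu N T S).real {τ | ∃ k : Fin (T + 1), ((k : ℕ) : ℤ) = t ∧ ∀ i, τ i k = Y.1 i}

/-- The product of `x j - x i` over all pairs `i < j`. -/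
def diffProd {N : ℕ} (x : Fin N → ℤ) : ℝ :=
  ∏ i, ∏ j ∈ Finset.Ioi i, ((x j : ℝ) - (x i : ℝ))

/-- The Pochhammer symbol `(a)_k = a (a + 1) ⋯ (a + k - 1)`. -/
def poch (a : ℝ) (k : ℕ) : ℝ := ∏ m ∈ Finset.range k, (a + m)

open Classical in
/-- The matrix `P_{t+}`, which increases `t` by one. -/
def PtPlus (N T : ℕ) (S t : ℤ) : Matrix (configs N T S t) (configs N T S (t + 1)) ℝ :=
  Matrix.of fun X Y =>
    if ∀ i, Y.1 i - X.1 i = 0 ∨ Y.1 i - X.1 i = 1 then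
      (diffProd Y.1 * (∏ i with Y.1 i = X.1 i + 1, ((N : ℝ) + S - X.1 i - 1)) *
          ∏ i with Y.1 i = X.1 i, ((X.1 i : ℝ) + T - t - S)) /
        (poch ((T : ℝ) - t) N * diffProd X.1)
    else 0

open Classical in
/-- The matrix `P_{S+}`, which increases `S` by one. -/
def PSPlus (N T : ℕ) (S t : ℤ) : Matrix (configs N T S t) (configs N T (S + 1) t) ℝ :=
  Matrix.of fun X Y =>
    if ∀ i, Y.1 i - X.1 i = 0 ∨ Y.1 i - X.1 i = 1 then
      (diffProd Y.1 * (∏ i with Y.1 i = X.1 i + 1, ((N : ℝ) + t - X.1 i - 1)) *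
          ∏ i with Y.1 i = X.1 i, ((X.1 i : ℝ) + T - t - S)) /
        (poch ((T : ℝ) - S) N * diffProd X.1)
    else 0

open Classical in
/-- The matrix `P_{t-}`, which decreases `t` by one. -/
def PtMinus (N T : ℕ) (S t : ℤ) : Matrix (configs N T S t) (configs N T S (t - 1)) ℝ :=
  Matrix.of fun X Y =>
    if ∀ i, Y.1 i - X.1 i = -1 ∨ Y.1 i - X.1 i = 0 then
      (diffProd Y.1 * (∏ i with Y.1 i = X.1 i - 1, (X.1 i : ℝ)) *
          ∏ i with Y.1 i = X.1 i, ((t : ℝ) + N - 1 - X.1 i)) /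
        (poch (t : ℝ) N * diffProd X.1)
    else 0

open Classical in
/-- The matrix `P_{S-}`, which decreases `S` by one. -/
def PSMinus (N T : ℕ) (S t : ℤ) : Matrix (configs N T S t) (configs N T (S - 1) t) ℝ :=
  Matrix.of fun X Y =>
    if ∀ i, Y.1 i - X.1 i = -1 ∨ Y.1 i - X.1 i = 0 then
      (diffProd Y.1 * (∏ i with Y.1 i = X.1 i - 1, (X.1 i : ℝ)) *
          ∏ i with Y.1 i = X.1 i, ((S : ℝ) + N - 1 - X.1 i)) /
        (poch (S : ℝ) N * diffProd X.1)
    else 0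

/-- A (rectangular) real matrix is stochastic if its entries are nonnegative and the entries of
every row sum to one. -/
def IsStochastic {m n : Type*} [Fintype n] (P : Matrix m n ℝ) : Prop :=
  (∀ i j, 0 ≤ P i j) ∧ ∀ i, ∑ j, P i j = 1

end LozengePaths

end

noncomputable section

namespace LozengePaths

open Finset Nat

/-! All four matrices are Doob transforms. Let `h n x` be the number of non-intersecting families
with `n` steps in `{0, c}` from `x` to a packed configuration. It has the closed form `pathCount`: a
Vandermonde product times one-point weights. Cutting a path family at `t` gives `ρ = K * forward
count * backward count`, and the matrix moving `t` by `c` has entries `h n Y / h (n + 1) X`. Its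
rows sum to one because `h (n + 1)` sums `h n` over neighbours (`sum_pathCount_shift`). It carries
`ρ` to `ρ` because the forward counts telescope and the backward count obeys the same recursion with
`-c`.

The recursion rests on `sum_diffProd_shift`: a first-order difference operator that is triangular on
monomials acts on a Vandermonde determinant by a scalar.

For the `S`-matrices, the closed form shows that `ρ` is symmetric in `S` and `t`
(`pathCount_mul_pathCount_comm`). Hence the same argument applies with the two parameters exchanged.
-/

/-- The reciprocal factorial, extended by zero to the negative integers. -/
def invFact (k : ℤ) : ℝ := if 0 ≤ k then ((k.toNat ! : ℕ) : ℝ)⁻¹ else 0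

lemma invFact_natCast (n : ℕ) : invFact n = ((n ! : ℕ) : ℝ)⁻¹ := by
  simp [invFact]

lemma invFact_nonneg (k : ℤ) : 0 ≤ invFact k := by
  unfold invFact; split_ifs <;> positivity

lemma invFact_pos {k : ℤ} (hk : 0 ≤ k) : 0 < invFact k := by
  unfold invFact; rw [if_pos hk]; positivity

lemma invFact_of_neg {k : ℤ} (hk : k < 0) : invFact k = 0 := if_neg (not_le.2 hk)

/-- For `k ≤ 0` both sides vanish, so weight identities need no range conditions. -/
lemma invFact_sub_one (k : ℤ) : invFact (k - 1) = k * invFact k := by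
  rcases lt_trichotomy k 0 with hk | rfl | hk
  · rw [invFact_of_neg hk, invFact_of_neg (by omega), mul_zero]
  · rw [invFact_of_neg (by omega)]; simp
  · obtain ⟨n, rfl⟩ : ∃ n : ℕ, k = (n + 1 : ℕ) := ⟨(k - 1).toNat, by omega⟩
    rw [show (((n + 1 : ℕ) : ℤ) - 1) = (n : ℕ) by push_cast; ring, invFact_natCast,
      invFact_natCast, factorial_succ]
    push_cast
    have : ((n ! : ℕ) : ℝ) ≠ 0 := by positivity
    field_simp

variable {N : ℕ}

/-- The tuple `x` with the entries labelled by `s` moved by `c`. -/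
def shift (c : ℤ) (x : Fin N → ℤ) (s : Finset (Fin N)) : Fin N → ℤ :=
  fun i => if i ∈ s then x i + c else x i

lemma diffProd_eq_det (x : Fin N → ℤ) :
    diffProd x = (Matrix.vandermonde fun i => (x i : ℝ)).det := by
  rw [Matrix.det_vandermonde]; rfl

lemma diffProd_pos {x : Fin N → ℤ} (hx : StrictMono x) : 0 < diffProd x := by
  refine prod_pos fun i _ => prod_pos fun j hj => ?_
  have := hx (mem_Ioi.1 hj)
  rw [sub_pos]
  exact_mod_cast this

lemma diffProd_eq_zero {x : Fin N → ℤ} {i j : Fin N} (hij : i < j) (h : x i = x j) :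
    diffProd x = 0 :=
  prod_eq_zero (mem_univ i) (prod_eq_zero (mem_Ioi.2 hij) (by rw [h, sub_self]))

/-! ### A difference operator acting on Vandermonde determinants. -/

section Algebra

open Polynomial

/-- The image of `X ^ k` under the difference operator
`p ↦ (a - c x) p (x + c) + (b + c x) p (x)`. -/
def differencePoly (a b c : ℝ) (k : ℕ) : ℝ[X] :=
  (C a - C c * X) * (X + C c) ^ k + (C b + C c * X) * X ^ k

lemma eval_differencePoly (a b c : ℝ) (k : ℕ) (x : ℝ) :
    (differencePoly a b c k).eval x = (a - c * x) * (x + c) ^ k + (b + c * x) * x ^ k := by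
  simp [differencePoly]

/-- The two terms of degree `k + 1`, with coefficients `-c` and `c`, cancel. -/
lemma natDegree_differencePoly_le (a b c : ℝ) (k : ℕ) : (differencePoly a b c k).natDegree ≤ k := by
  rw [natDegree_le_iff_coeff_eq_zero]
  intro m hm
  obtain ⟨m, rfl⟩ : ∃ l, m = l + 1 := ⟨m - 1, by omega⟩
  have h1 : differencePoly a b c k = C a * (X + C c) ^ k - C c * (X * (X + C c) ^ k)
      + (C b * X ^ k + C c * (X * X ^ k)) := by
    unfold differencePoly; ring
  rw [h1]
  simp only [coeff_add, coeff_sub, coeff_C_mul, coeff_X_mul, coeff_X_add_C_pow, coeff_X_pow]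
  rcases (show k ≤ m by omega).eq_or_lt with rfl | h
  · simp
  · simp [Nat.choose_eq_zero_of_lt h, Nat.choose_eq_zero_of_lt hm, h.ne', hm.ne']

lemma coeff_differencePoly (a b : ℝ) {c : ℝ} (hc : c * c = 1) (k : ℕ) :
    (differencePoly a b c k).coeff k = a + b - k := by
  have h1 : differencePoly a b c k = C a * (X + C c) ^ k - C c * (X * (X + C c) ^ k)
      + (C b * X ^ k + C c * (X * X ^ k)) := by
    unfold differencePoly; ring
  rw [h1]
  cases k with
  | zero => simp
  | succ k =>
    simp only [coeff_add, coeff_sub, coeff_C_mul, coeff_X_mul, coeff_X_add_C_pow, coeff_X_pow]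
    simp [← mul_assoc, hc]
    ring

/-- Multilinearity in the rows makes the left side the expansion of one determinant, whose row `i`
lists the values at `x i` of the polynomials `differencePoly a b c k`. These values are the
Vandermonde matrix times a triangular coefficient matrix with diagonal `a + b - k`. -/
lemma sum_diffProd_shift (a b : ℝ) {c : ℤ} (hc : c * c = 1) (x : Fin N → ℤ) :
    ∑ s : Finset (Fin N), diffProd (shift c x s) *
        ∏ i, (if i ∈ s then a - c * x i else b + c * x i) =
      (∏ k : Fin N, (a + b - (k : ℕ))) * diffProd x := by
  have hc' : (c : ℝ) * c = 1 := by exact_mod_cast hc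
  have key := Matrix.eval_matrixOfPolynomials_eq_vandermonde_mul_matrixOfPolynomials
    (fun i => (x i : ℝ)) (fun k : Fin N => differencePoly a b c k)
    (fun k => natDegree_differencePoly_le a b c k)
  have hdet := congrArg Matrix.det key
  have htri : (Matrix.of fun i j : Fin N =>
      (differencePoly a b (c : ℝ) (j : ℕ)).coeff i).IsUpperTriangular := by
    intro i j hij
    exact coeff_eq_zero_of_natDegree_lt ((natDegree_differencePoly_le a b c j).trans_lt hij)
  rw [Matrix.det_mul, ← diffProd_eq_det, Matrix.det_of_isUpperTriangular htri] at hdet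
  simp only [Matrix.of_apply, coeff_differencePoly a b hc'] at hdet
  rw [mul_comm, ← hdet]
  have h2 : (Matrix.of fun i j : Fin N => (differencePoly a b c (j : ℕ)).eval (x i : ℝ)) =
      (fun i : Fin N => (a - c * x i) • fun j : Fin N => ((x i : ℝ) + c) ^ (j : ℕ)) +
      (fun i : Fin N => (b + c * x i) • fun j : Fin N => (x i : ℝ) ^ (j : ℕ)) := by
    ext i j
    simp [eval_differencePoly]
  rw [h2]
  have h3 := (Matrix.detRowAlternating (R := ℝ) (n := Fin N)).toMultilinearMap.map_add_univ
    (fun i : Fin N => (a - c * x i) • fun j : Fin N => ((x i : ℝ) + c) ^ (j : ℕ))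
    (fun i : Fin N => (b + c * x i) • fun j : Fin N => (x i : ℝ) ^ (j : ℕ))
  refine Eq.trans ?_ h3.symm
  refine sum_congr rfl fun s _ => ?_
  rw [diffProd_eq_det, mul_comm, ← Matrix.det_mul_column]
  refine congrArg Matrix.det ?_
  ext i j
  by_cases hi : i ∈ s <;> simp [hi, shift, Matrix.vandermonde_apply]

end Algebra

/-! ### The product formula and its recursion. -/

/-- The closed formula for the number of families of non-intersecting paths with `n` steps in
`{0, c}` from `x` to the densely packed configuration. -/
def pathCount (n : ℕ) (c a : ℤ) (x : Fin N → ℤ) : ℝ :=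
  diffProd x * ∏ i : Fin N, (((n + i) ! : ℕ) * invFact (a - c * x i) *
    invFact (n + N - 1 - a + c * x i))

/-- The product of the factors attached to the moving and to the resting points of `x`. -/
def stepFactor (n : ℕ) (c a : ℤ) (x y : Fin N → ℤ) : ℝ :=
  (∏ i with y i = x i + c, ((a : ℝ) - c * x i)) *
    ∏ i with y i = x i, ((n : ℝ) + N - a + c * x i)

lemma poch_succ_mul_prod_factorial (n : ℕ) :
    poch ((n : ℝ) + 1) N * ∏ i : Fin N, (((n + i) ! : ℕ) : ℝ) =
      ∏ i : Fin N, (((n + 1 + i) ! : ℕ) : ℝ) := by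
  rw [poch, ← Fin.prod_univ_eq_prod_range (fun m => (n : ℝ) + 1 + m), ← prod_mul_distrib]
  refine prod_congr rfl fun i _ => ?_
  rw [show n + 1 + (i : ℕ) = (n + i) + 1 by ring, factorial_succ]
  push_cast; ring

lemma poch_succ_pos (n : ℕ) : 0 < poch ((n : ℝ) + 1) N :=
  prod_pos fun _ _ => by positivity

lemma stepFactor_shift (n : ℕ) {c : ℤ} (hc : c ≠ 0) (a : ℤ) (x : Fin N → ℤ) (s : Finset (Fin N)) :
    stepFactor n c a x (shift c x s) =
      ∏ i, (if i ∈ s then (a : ℝ) - c * x i else (n + N - a) + c * x i) := by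
  rw [stepFactor, prod_ite]
  congr 1
  · refine prod_congr (filter_congr fun i _ => ?_) fun _ _ => rfl
    by_cases hi : i ∈ s <;> simp [shift, hi, hc]
  · refine prod_congr (filter_congr fun i _ => ?_) fun _ _ => rfl
    by_cases hi : i ∈ s <;> simp [shift, hi, hc]

/-- Passing from `n + 1` to `n`, a moving point lowers the argument of its first reciprocal
factorial by one and a resting point that of its second. Each drop releases one linear factor of
`stepFactor`; the factorials `(n + i)!` account for the Pochhammer symbol. -/
lemma pathCount_shift (n : ℕ) {c : ℤ} (hc : c * c = 1) (a : ℤ) (x : Fin N → ℤ)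
    (s : Finset (Fin N)) :
    poch ((n : ℝ) + 1) N * pathCount n c a (shift c x s) =
      diffProd (shift c x s) * stepFactor n c a x (shift c x s) *
        ∏ i : Fin N, (((n + 1 + i) ! : ℕ) * invFact (a - c * x i) *
          invFact ((n + 1 : ℕ) + N - 1 - a + c * x i)) := by
  have hc0 : c ≠ 0 := by rintro rfl; simp at hc
  rw [stepFactor_shift n hc0, pathCount]
  simp only [mul_assoc, prod_mul_distrib (s := univ) (f := fun i : Fin N => (((n + 1 + i) ! : ℕ) : ℝ)),
    prod_mul_distrib (s := univ) (f := fun i : Fin N => (((n + i) ! : ℕ) : ℝ))]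
  rw [← poch_succ_mul_prod_factorial]
  have h : ∏ i : Fin N, (invFact (a - c * shift c x s i) *
        invFact (n + N - 1 - a + c * shift c x s i)) =
      (∏ i, (if i ∈ s then (a : ℝ) - c * x i else (n + N - a) + c * x i)) *
        ∏ i : Fin N, (invFact (a - c * x i) *
          invFact ((n + 1 : ℕ) + N - 1 - a + c * x i)) := ?_
  · rw [h]; ring
  rw [← prod_mul_distrib]
  refine prod_congr rfl fun i _ => ?_
  by_cases hi : i ∈ s
  · simp only [shift, hi, if_true]
    rw [show a - c * (x i + c) = a - c * x i - 1 by rw [mul_add, hc]; ring, invFact_sub_one,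
      show (n : ℤ) + N - 1 - a + c * (x i + c) = (n + 1 : ℕ) + N - 1 - a + c * x i by
        rw [mul_add, hc]; push_cast; ring]
    push_cast; ring
  · simp only [shift, hi, if_false]
    rw [show (n : ℤ) + N - 1 - a + c * x i = ((n + 1 : ℕ) + N - 1 - a + c * x i) - 1 by
        push_cast; ring, invFact_sub_one]
    push_cast; ring

lemma sum_pathCount_shift (n : ℕ) {c : ℤ} (hc : c * c = 1) (a : ℤ) (x : Fin N → ℤ) :
    ∑ s, pathCount n c a (shift c x s) = pathCount (n + 1) c a x := by
  have hc0 : c ≠ 0 := by rintro rfl; simp at hc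
  refine mul_left_cancel₀ (poch_succ_pos (N := N) n).ne' ?_
  rw [mul_sum, sum_congr rfl fun s _ => pathCount_shift n hc a x s, ← sum_mul,
    sum_congr rfl fun s _ => by rw [stepFactor_shift n hc0 a x s],
    -- The two constants add up to `n + N`, so the scalar is the product of `n + N - k`, which is
    -- the Pochhammer symbol read backwards.
    sum_diffProd_shift (a : ℝ) (n + N - a) hc, pathCount, ← mul_assoc]
  congr 2
  rw [poch, ← Fin.prod_univ_eq_prod_range (fun m => (n : ℝ) + 1 + m),
    ← Equiv.prod_comp Fin.revPerm]
  refine prod_congr rfl fun i _ => ?_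
  rw [Fin.revPerm_apply, Fin.val_rev, Nat.cast_sub (by omega)]
  push_cast; ring

lemma pathCount_nonneg (n : ℕ) (c a : ℤ) {x : Fin N → ℤ} (hx : StrictMono x) :
    0 ≤ pathCount n c a x :=
  mul_nonneg (diffProd_pos hx).le (prod_nonneg fun _ _ =>
    mul_nonneg (mul_nonneg (by positivity) (invFact_nonneg _)) (invFact_nonneg _))

lemma pathCount_pos {n : ℕ} {c a : ℤ} {x : Fin N → ℤ} (hx : StrictMono x)
    (h : ∀ i, 0 ≤ a - c * x i ∧ 0 ≤ n + N - 1 - a + c * x i) : 0 < pathCount n c a x :=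
  mul_pos (diffProd_pos hx) (prod_pos fun i _ =>
    mul_pos (mul_pos (by positivity) (invFact_pos (h i).1)) (invFact_pos (h i).2))

/-- The reciprocal factorials enforce the walls of the hexagon. -/
lemma bounds_of_pathCount_ne_zero {n : ℕ} {c a : ℤ} {x : Fin N → ℤ} (h : pathCount n c a x ≠ 0)
    (i : Fin N) : 0 ≤ a - c * x i ∧ 0 ≤ n + N - 1 - a + c * x i := by
  contrapose! h
  refine mul_eq_zero_of_right _ (prod_eq_zero (mem_univ i) ?_)
  by_cases h1 : 0 ≤ a - c * x i
  · rw [invFact_of_neg (h h1), mul_zero]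
  · rw [invFact_of_neg (not_le.1 h1), mul_zero, zero_mul]

/-- Unit moves let neighbouring points collide but never cross, and a collision kills the
Vandermonde product. -/
lemma strictMono_shift_of_pathCount_ne_zero {n : ℕ} {c a : ℤ} (hc : c * c = 1) {x : Fin N → ℤ}
    (hx : StrictMono x) {s : Finset (Fin N)} (h : pathCount n c a (shift c x s) ≠ 0) :
    StrictMono (shift c x s) := by
  intro i j hij
  by_contra hlt
  refine h (mul_eq_zero_of_left (diffProd_eq_zero hij ?_) _)
  have := hx hij
  have hc' : c = 1 ∨ c = -1 := mul_self_eq_one_iff.1 hc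
  unfold shift at hlt ⊢
  split_ifs at hlt ⊢ <;> omega

/-- The densely packed configuration starting at `b`. -/
def packed (N : ℕ) (b : ℤ) : Fin N → ℤ := fun i => b + (i : ℕ)

lemma strictMono_packed (b : ℤ) : StrictMono (packed N b) := fun i j hij => by
  unfold packed
  have : (i : ℕ) < j := hij
  omega

/-- A strictly increasing self-map of `Fin N` is the identity. -/
lemma eq_packed_of_strictMono {b : ℤ} {x : Fin N → ℤ} (hx : StrictMono x)
    (h : ∀ i, b ≤ x i ∧ x i ≤ b + N - 1) : x = packed N b := by
  have hf : ∀ i, (x i - b).toNat < N := fun i => by have := h i; omega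
  have hmono : StrictMono fun i => (⟨(x i - b).toNat, hf i⟩ : Fin N) := fun i j hij => by
    have h1 := hx hij
    have := h i
    rw [Fin.lt_def]
    simp only
    omega
  funext i
  have h1 := hmono.le_apply (x := i)
  have h2 := hmono.apply_le (x := i)
  have := h i
  rw [Fin.le_def] at h1 h2
  simp only at h1 h2
  unfold packed
  omega

/-- The Vandermonde determinant is translation invariant; at `0, …, N - 1` it is a superfactorial.
-/
lemma diffProd_packed (b : ℤ) :
    diffProd (packed N b) = ∏ i : Fin N, (((i : ℕ) ! : ℕ) : ℝ) := by
  cases N with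
  | zero => simp [diffProd]
  | succ n =>
    rw [diffProd_eq_det]
    have h1 := Matrix.det_vandermonde_id_eq_superFactorial (R := ℝ) n
    have h2 := Matrix.det_vandermonde_add (fun i : Fin (n + 1) => ((i : ℕ) : ℝ)) (b : ℝ)
    rw [h1] at h2
    rw [show (fun i => ((packed (n + 1) b i : ℤ) : ℝ)) =
      fun i : Fin (n + 1) => (((i : ℕ) : ℝ) + (b : ℝ)) by
        funext i; simp [packed, add_comm], h2, ← Nat.prod_range_succ_factorial,
      Nat.cast_prod, Fin.prod_univ_eq_prod_range (fun i => ((i ! : ℕ) : ℝ))]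

lemma prod_invFact_rev (n : ℤ) :
    ∏ i : Fin N, invFact (n + N - 1 - (i : ℕ)) = ∏ i : Fin N, invFact (n + (i : ℕ)) := by
  rw [← Equiv.prod_comp Fin.revPerm]
  refine prod_congr rfl fun i _ => ?_
  rw [Fin.revPerm_apply, Fin.val_rev, Nat.cast_sub (by omega)]
  congr 1; push_cast; ring

lemma prod_invFact_natCast_add (n : ℕ) :
    ∏ i : Fin N, invFact ((n : ℤ) + (i : ℕ)) = (∏ i : Fin N, (((n + i) ! : ℕ) : ℝ))⁻¹ := by
  rw [← prod_inv_distrib]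
  exact prod_congr rfl fun i _ => by rw [← invFact_natCast]; push_cast; rfl

/-- The hypothesis fixes `a` so that `a - c * x` is the distance from `x` to the extreme point of
the packed target in direction `c`: the top one for `c = 1`, the bottom one for `c = -1`. -/
lemma pathCount_zero_packed {c a b : ℤ} (h : c = 1 ∧ a = b + N - 1 ∨ c = -1 ∧ a = -b) :
    pathCount 0 c a (packed N b) = 1 := by
  have e1 := prod_invFact_rev (N := N) 0
  have e2 := prod_invFact_natCast_add (N := N) 0
  simp only [Nat.cast_zero, zero_add] at e1 e2
  have e3 : ∏ i : Fin N, (((i : ℕ) ! : ℕ) : ℝ) ≠ 0 := prod_ne_zero_iff.2 fun _ _ => by positivity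
  have : ∀ i : Fin N, invFact (a - c * packed N b i) *
      invFact ((0 : ℕ) + N - 1 - a + c * packed N b i) =
      invFact ((i : ℕ) : ℤ) * invFact (N - 1 - (i : ℕ)) := by
    intro i
    unfold packed
    rcases h with ⟨rfl, rfl⟩ | ⟨rfl, rfl⟩
    · rw [mul_comm]
      congr 2 <;> push_cast <;> ring
    · congr 2 <;> push_cast <;> ring
  rw [pathCount, diffProd_packed]
  simp only [mul_assoc, this, prod_mul_distrib, zero_add, e1, e2]
  field_simp

/-- With no steps left, the two reciprocal factorials confine `x` to a window of `N` integers. -/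
lemma pathCount_zero {c a b : ℤ} (h : c = 1 ∧ a = b + N - 1 ∨ c = -1 ∧ a = -b) {x : Fin N → ℤ}
    (hx : StrictMono x) : pathCount 0 c a x = if x = packed N b then 1 else 0 := by
  split_ifs with hxb
  · rw [hxb, pathCount_zero_packed h]
  · by_contra hne
    refine hxb (eq_packed_of_strictMono hx fun i => ?_)
    have := bounds_of_pathCount_ne_zero hne i
    rcases h with ⟨rfl, rfl⟩ | ⟨rfl, rfl⟩ <;> constructor <;> push_cast at this <;> linarith

/-! ### Chains of configurations and their number. -/

/-- The sequences of `n + 1` increasing configurations from `x` to `e` in which every point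
moves by `0` or `c` at each step. -/
def chains (c : ℤ) (n : ℕ) (x e : Fin N → ℤ) : Set (Fin (n + 1) → Fin N → ℤ) :=
  {f | f 0 = x ∧ f (Fin.last n) = e ∧ (∀ k, StrictMono (f k)) ∧
    ∀ k : Fin n, ∀ i, f k.succ i = f k.castSucc i ∨ f k.succ i = f k.castSucc i + c}

lemma chains_eq_empty {c : ℤ} {n : ℕ} {x e : Fin N → ℤ} (hx : ¬ StrictMono x) :
    chains c n x e = ∅ :=
  Set.eq_empty_of_forall_notMem fun _ hf => hx (hf.1 ▸ hf.2.2.1 0)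

lemma shift_injective {c : ℤ} (hc : c ≠ 0) (x : Fin N → ℤ) :
    Function.Injective (shift c x) := by
  intro s s' h
  ext i
  have := congrFun h i
  unfold shift at this
  split_ifs at this with h1 h2 h2 <;> simp_all

lemma exists_eq_shift {c : ℤ} {x y : Fin N → ℤ} (h : ∀ i, y i = x i ∨ y i = x i + c) :
    ∃ s, shift c x s = y := by
  refine ⟨univ.filter fun i => y i ≠ x i, funext fun i => ?_⟩
  by_cases hi : y i = x i
  · simp [shift, hi]
  · simp [shift, (h i).resolve_left hi]

lemma shift_eq_or (c : ℤ) (x : Fin N → ℤ) (s : Finset (Fin N)) (i : Fin N) :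
    shift c x s i = x i ∨ shift c x s i = x i + c := by
  unfold shift; split_ifs <;> simp

lemma cons_mem_chains {c : ℤ} {n : ℕ} {x e : Fin N → ℤ} (hx : StrictMono x) {s : Finset (Fin N)}
    {g : Fin (n + 1) → Fin N → ℤ} (hg : g ∈ chains c n (shift c x s) e) :
    (Fin.cons x g : Fin (n + 2) → Fin N → ℤ) ∈ chains c (n + 1) x e := by
  obtain ⟨h0, h1, h2, h3⟩ := hg
  refine ⟨rfl, ?_, fun k => ?_, fun k => ?_⟩
  · rw [← Fin.succ_last, Fin.cons_succ, h1]
  · cases k using Fin.cases with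
    | zero => exact hx
    | succ k => exact h2 k
  · cases k using Fin.cases with
    | zero =>
      intro i
      rw [Fin.cons_succ, h0]
      exact shift_eq_or c x s i
    | succ k => exact h3 k

/-- Prepending a configuration to a chain which starts at one of its neighbours. -/
def consChain {c : ℤ} {n : ℕ} {x e : Fin N → ℤ} (hx : StrictMono x)
    (p : Σ s : Finset (Fin N), chains c n (shift c x s) e) : chains c (n + 1) x e :=
  ⟨Fin.cons x p.2.1, cons_mem_chains hx p.2.2⟩

lemma consChain_bijective {c : ℤ} (hc : c ≠ 0) {n : ℕ} {x e : Fin N → ℤ} (hx : StrictMono x) :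
    Function.Bijective (consChain (c := c) (n := n) (e := e) hx) := by
  constructor
  · rintro ⟨s, g, hg⟩ ⟨s', g', hg'⟩ h
    have h1 : g = g' := Fin.cons_right_injective (α := fun _ => Fin N → ℤ) x
      (congrArg Subtype.val h)
    have h2 : s = s' := shift_injective hc x (by rw [← hg.1, ← hg'.1, h1])
    subst h1 h2
    rfl
  · rintro ⟨f, h0, h1, h2, h3⟩
    obtain ⟨s, hs⟩ := exists_eq_shift (c := c) (x := x) (y := f 1) fun i => by
      have := h3 0 i
      rwa [Fin.succ_zero_eq_one, Fin.castSucc_zero, h0] at this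
    refine ⟨⟨s, Fin.tail f, ?_, ?_, fun k => h2 _, fun k => ?_⟩, Subtype.ext ?_⟩
    · rw [hs]; rfl
    · rw [← h1, Fin.tail, Fin.succ_last]
    · exact h3 k.succ
    · change Fin.cons x (Fin.tail f) = f
      rw [← h0, Fin.cons_self_tail]

lemma chains_zero (c : ℤ) {x e : Fin N → ℤ} (hx : StrictMono x) :
    chains c 0 x e = if x = e then {fun _ => x} else ∅ := by
  ext f
  split_ifs with h
  · subst h
    simp only [chains, Set.mem_ofPred_eq, Set.mem_singleton_iff]
    constructor
    · rintro ⟨h0, -⟩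
      funext k
      rw [Fin.fin_one_eq_zero k, h0]
    · rintro rfl
      exact ⟨rfl, rfl, fun _ => hx, fun k => k.elim0⟩
  · simp only [Set.mem_empty_iff_false, iff_false]
    rintro ⟨h0, h1, -⟩
    exact h (h0.symm.trans h1)

lemma finite_chains {c : ℤ} (hc : c ≠ 0) (n : ℕ) (x e : Fin N → ℤ) : (chains c n x e).Finite := by
  by_cases hx : StrictMono x
  swap
  · rw [chains_eq_empty hx]; exact Set.finite_empty
  induction n generalizing x with
  | zero => rw [chains_zero c hx]; split_ifs <;> simp
  | succ n ih =>
    have : ∀ s, Finite (chains c n (shift c x s) e) := fun s => by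
      by_cases hs : StrictMono (shift c x s)
      · exact (ih _ hs).to_subtype
      · rw [chains_eq_empty hs]; infer_instance
    exact Set.finite_coe_iff.1 (Finite.of_surjective _ (consChain_bijective hc hx).2)

/-- Splitting off the first step gives the chains the recursion `sum_pathCount_shift`. Shifts with a
collision contribute zero to both sides. -/
lemma card_chains {c a b : ℤ} (h : c = 1 ∧ a = b + N - 1 ∨ c = -1 ∧ a = -b) (n : ℕ)
    {x : Fin N → ℤ} (hx : StrictMono x) :
    (Nat.card (chains c n x (packed N b)) : ℝ) = pathCount n c a x := by
  have hc : c * c = 1 := by rcases h with ⟨rfl, -⟩ | ⟨rfl, -⟩ <;> rfl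
  have hc0 : c ≠ 0 := by rintro rfl; simp at hc
  induction n generalizing x with
  | zero =>
    rw [pathCount_zero h hx, chains_zero c hx]
    split_ifs <;> simp
  | succ n ih =>
    have : ∀ s, Finite (chains c n (shift c x s) (packed N b)) := fun s =>
      (finite_chains hc0 _ _ _).to_subtype
    rw [← Nat.card_congr (Equiv.ofBijective _ (consChain_bijective hc0 hx)), Nat.card_sigma,
      ← sum_pathCount_shift n hc, Nat.cast_sum]
    refine sum_congr rfl fun s _ => ?_
    by_cases hs : StrictMono (shift c x s)
    · exact ih hs
    · rw [chains_eq_empty hs]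
      simp only [Nat.card_eq_fintype_card, Fintype.card_eq_zero, Nat.cast_zero]
      by_contra hne
      exact hs (strictMono_shift_of_pathCount_ne_zero hc hx (Ne.symm hne))

/-! ### Cutting path families into two chains. -/

lemma mem_Omega_iff {T : ℕ} {S : ℤ} {τ : PathFamily N T} :
    τ ∈ Omega N T S ↔ (∀ i, τ i 0 = packed N 0 i) ∧ (∀ i, τ i (Fin.last T) = packed N S i) ∧
      (∀ k, StrictMono fun i => τ i k) ∧
      ∀ k (hk : k < T) i, τ i ⟨k + 1, by omega⟩ = τ i ⟨k, by omega⟩ ∨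
        τ i ⟨k + 1, by omega⟩ = τ i ⟨k, by omega⟩ + 1 := by
  constructor
  · rintro ⟨h0, h1, h2, h3⟩
    refine ⟨fun i => by rw [h0, packed, zero_add], h1, fun k => ?_, fun k hk i => ?_⟩
    -- Ordered integers that differ by at least one and move by `0` or `1` must meet before they can
    -- swap; disjointness therefore preserves the order.
    · induction k using Fin.induction with
      | zero =>
        intro i j hij
        have : (i : ℕ) < j := hij
        simp only [h0]
        omega
      | succ k ih =>
        intro i j hij
        have e1 := ih hij
        have e2 := h3 i j hij.ne k.succ
        have e3 := h2 i k
        have e4 := h2 j k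
        simp only at e1 ⊢
        omega
    · have : τ i ⟨k + 1, by omega⟩ - τ i ⟨k, by omega⟩ = 0 ∨
        τ i ⟨k + 1, by omega⟩ - τ i ⟨k, by omega⟩ = 1 := h2 i ⟨k, hk⟩
      omega
  · rintro ⟨h0, h1, h2, h3⟩
    refine ⟨fun i => by rw [h0, packed, zero_add], h1, fun i k => ?_, fun i j hij k h => ?_⟩
    · have : τ i k.succ = τ i k.castSucc ∨ τ i k.succ = τ i k.castSucc + 1 := h3 k k.2 i
      omega
    · exact hij ((h2 k).injective h)

/-- The family of paths which follows `g` backwards and then `h`. -/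
def glue {m n : ℕ} (g : Fin (m + 1) → Fin N → ℤ) (h : Fin (n + 1) → Fin N → ℤ) :
    PathFamily N (m + n) :=
  fun i k => if k.1 ≤ m then g ⟨m - k, by omega⟩ i else h ⟨k - m, by omega⟩ i

lemma glue_mem {m n : ℕ} {S : ℤ} {y : Fin N → ℤ} {g : Fin (m + 1) → Fin N → ℤ}
    {h : Fin (n + 1) → Fin N → ℤ} (hg : g ∈ chains (-1) m y (packed N 0))
    (hh : h ∈ chains 1 n y (packed N S)) :
    glue g h ∈ Omega N (m + n) S ∧ ∀ i, glue g h i ⟨m, by omega⟩ = y i := by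
  obtain ⟨g0, g1, g2, g3⟩ := hg
  obtain ⟨h0, h1, h2, h3⟩ := hh
  unfold glue
  refine ⟨mem_Omega_iff.2 ⟨fun i => ?_, fun i => ?_, fun k => ?_, fun k hk i => ?_⟩, fun i => ?_⟩
  · rw [if_pos (by simp), ← g1]; rfl
  -- `glue` takes the vertex at `m` from `g`; for `n = 0` this is also the last vertex, and the
  -- common value `y` identifies it with the end of `h`.
  · by_cases hn : n = 0
    · subst hn
      rw [if_pos (by simp)]
      have e : g ⟨m - (Fin.last (m + 0)).1, by omega⟩ = h (Fin.last 0) := by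
        rw [show Fin.last 0 = 0 from rfl, h0, ← g0]
        congr 1
        ext; simp
      rw [e, h1]
    · rw [if_neg (by simp [hn]), ← h1]
      congr 1
      ext; simp
  · by_cases hk : k.1 ≤ m
    · simp only [if_pos hk]; exact g2 _
    · simp only [if_neg hk]; exact h2 _
  · rcases lt_trichotomy k m with hkm | rfl | hkm
    · simp only [if_pos (show k + 1 ≤ m from hkm), if_pos hkm.le]
      have := g3 ⟨m - (k + 1), by omega⟩ i
      simp only [Fin.succ_mk, Fin.castSucc_mk, show m - (k + 1) + 1 = m - k by omega] at this
      omega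
    · have := h3 ⟨0, by omega⟩ i
      simp only [le_refl, if_true, add_le_iff_nonpos_right, nonpos_iff_eq_zero, one_ne_zero,
        if_false, Nat.sub_self, Nat.add_sub_cancel_left]
      have e1 : g ⟨0, by omega⟩ = h ⟨0, by omega⟩ := g0.trans h0.symm
      rw [e1]
      exact this
    · simp only [if_neg (show ¬ k + 1 ≤ m by omega), if_neg (show ¬ k ≤ m by omega)]
      have := h3 ⟨k - m, by omega⟩ i
      simpa only [Fin.succ_mk, Fin.castSucc_mk, show k - m + 1 = k + 1 - m by omega] using this
  · simp only [le_refl, if_true, Nat.sub_self]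
    exact congrFun g0 i

/-- Cutting a family of paths at the coordinate `m`. -/
def cutEquiv (m n : ℕ) (S : ℤ) (y : Fin N → ℤ) :
    {τ : PathFamily N (m + n) | τ ∈ Omega N (m + n) S ∧ ∀ i, τ i ⟨m, by omega⟩ = y i} ≃
      chains (-1) m y (packed N 0) × chains 1 n y (packed N S) where
  toFun τ := by
    refine ⟨⟨fun k i => τ.1 i ⟨m - k, by omega⟩, ?_⟩, ⟨fun k i => τ.1 i ⟨m + k, by omega⟩, ?_⟩⟩
    all_goals
      obtain ⟨τ, hτ, hy⟩ := τ
      obtain ⟨h0, h1, h2, h3⟩ := mem_Omega_iff.1 hτ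
    · refine ⟨funext hy, funext fun i => ?_, fun k => h2 _, fun k i => ?_⟩
      · simp [← h0 i]
      · have := h3 (m - (k + 1)) (by omega) i
        have e : m - (k + 1) + 1 = m - k := by omega
        simp only [e] at this
        simp only [Fin.val_succ, Fin.val_castSucc]
        omega
    · exact ⟨funext hy, funext h1, fun k => h2 _, fun k i => h3 (m + k) (by omega) i⟩
  invFun p := ⟨glue p.1.1 p.2.1, glue_mem p.1.2 p.2.2⟩
  left_inv := by
    rintro ⟨τ, hτ, hy⟩
    refine Subtype.ext (funext fun i => funext fun k => ?_)
    by_cases hk : k.1 ≤ m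
    · simp only [glue, if_pos hk]
      congr 1
      ext; simp only; omega
    · simp only [glue, if_neg hk]
      congr 1
      ext; simp only; omega
  right_inv := by
    rintro ⟨⟨g, g0, g1, g2, g3⟩, ⟨h, h0, h1, h2, h3⟩⟩
    refine Prod.ext (Subtype.ext (funext fun k => funext fun i => ?_))
      (Subtype.ext (funext fun k => funext fun i => ?_))
    · simp only [glue, Nat.sub_le, if_true]
      congr 1
      ext; simp only; omega
    · by_cases hk : (k : ℕ) = 0
      · have hk' : k = 0 := Fin.ext hk
        subst hk'
        simp only [glue, Fin.val_zero, add_zero, le_refl, if_true, Nat.sub_self]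
        exact congrFun (g0.trans h0.symm) i
      · simp only [glue, if_neg (show ¬ m + (k : ℕ) ≤ m by omega), Nat.add_sub_cancel_left]

lemma card_Omega_inter (m n : ℕ) (S : ℤ) {y : Fin N → ℤ} (hy : StrictMono y) :
    (Nat.card {τ : PathFamily N (m + n) | τ ∈ Omega N (m + n) S ∧ ∀ i, τ i ⟨m, by omega⟩ = y i} : ℝ)
      = pathCount m (-1) 0 y * pathCount n 1 (S + N - 1) y := by
  rw [Nat.card_congr (cutEquiv m n S y), Nat.card_prod, Nat.cast_mul,
    card_chains (a := 0) (b := 0) (Or.inr ⟨rfl, by simp⟩) m hy, card_chains (Or.inl ⟨rfl, rfl⟩) n hy]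

/-- The starting points are prescribed, so a cut at `0` imposes nothing. Finiteness and cardinality
of `Omega` thus become instances of the cut. -/
lemma Omega_eq_setOf_zero (T : ℕ) (S : ℤ) : Omega N (0 + T) S =
    {τ | τ ∈ Omega N (0 + T) S ∧ ∀ i, τ i ⟨0, by omega⟩ = packed N 0 i} := by
  ext τ
  exact ⟨fun h => ⟨h, (mem_Omega_iff.1 h).1⟩, fun h => h.1⟩

lemma finite_Omega (T : ℕ) (S : ℤ) : (Omega N T S).Finite := by
  obtain ⟨T, rfl⟩ : ∃ T', T = 0 + T' := ⟨T, by simp⟩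
  rw [Omega_eq_setOf_zero]
  have h1 := (finite_chains (c := -1) (by decide) 0 (packed N 0) (packed N 0)).to_subtype
  have h2 := (finite_chains (c := 1) (by decide) T (packed N 0) (packed N S)).to_subtype
  exact Set.finite_coe_iff.1 (Finite.of_equiv _ (cutEquiv 0 T S (packed N 0)).symm)

lemma card_Omega (T : ℕ) (S : ℤ) :
    (Nat.card (Omega N T S) : ℝ) = pathCount T 1 (S + N - 1) (packed N 0) := by
  obtain ⟨n, rfl⟩ : ∃ n, T = 0 + n := ⟨T, (zero_add T).symm⟩
  have h := card_Omega_inter 0 n S (strictMono_packed (N := N) 0)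
  rw [← Omega_eq_setOf_zero, pathCount_zero_packed (b := 0) (Or.inr ⟨rfl, by simp⟩), one_mul] at h
  rw [h, zero_add]

/-! ### The one-time distribution and its symmetry in `S` and `t`. -/

lemma uniformOn_real_apply {α : Type*} [MeasurableSpace α] [MeasurableSingletonClass α] {s : Set α}
    (hs : s.Finite) (t : Set α) :
    (ProbabilityTheory.uniformOn s).real t =
      (Nat.card ↥(s ∩ t) : ℝ) / (Nat.card s : ℝ) := by
  rw [ProbabilityTheory.uniformOn, MeasureTheory.measureReal_def,
    ProbabilityTheory.cond_apply hs.measurableSet,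
    MeasureTheory.Measure.count_apply_finite _ hs,
    MeasureTheory.Measure.count_apply_finite _ (hs.inter_of_left t), ENNReal.toReal_mul,
    ENNReal.toReal_inv, ENNReal.toReal_natCast, ENNReal.toReal_natCast,
    Nat.card_coe_set_eq, Nat.card_coe_set_eq, Set.ncard_eq_toFinset_card _ hs,
    Set.ncard_eq_toFinset_card _ (hs.inter_of_left t), mul_comm, div_eq_mul_inv]

lemma mem_configs {T : ℕ} {S t : ℤ} {x : Fin N → ℤ} :
    x ∈ configs N T S t ↔ StrictMono x ∧
      ∀ i, (0 ≤ x i ∧ t + S - T ≤ x i) ∧ x i ≤ t + N - 1 ∧ x i ≤ S + N - 1 := by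
  simp only [configs, mem_filter, Fintype.mem_piFinset, sectionPoints, mem_Icc, max_le_iff,
    le_min_iff]
  exact ⟨fun h => ⟨fun i j hij => h.2 i j hij, h.1⟩, fun h => ⟨h.2, fun i j hij => h.1 hij⟩⟩

lemma rho_eq {T : ℕ} {S t : ℤ} {m n : ℕ} (ht : t = m) (hT : (T : ℤ) = m + n)
    (Y : configs N T S t) :
    rho N T S t Y = (pathCount T 1 (S + N - 1) (packed N 0))⁻¹ * pathCount n 1 (S + N - 1) Y.1 *
      pathCount m (-1) 0 Y.1 := by
  obtain rfl : T = m + n := by omega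
  subst ht
  rw [rho, mu, uniformOn_real_apply (finite_Omega _ _), card_Omega]
  have h : Omega N (m + n) S ∩ {τ | ∃ k : Fin (m + n + 1), ((k : ℕ) : ℤ) = m ∧
      ∀ i, τ i k = Y.1 i} =
      {τ | τ ∈ Omega N (m + n) S ∧ ∀ i, τ i ⟨m, by omega⟩ = Y.1 i} := by
    ext τ
    constructor
    · rintro ⟨h1, k, hk, h2⟩
      have hk' : (⟨m, by omega⟩ : Fin (m + n + 1)) = k := Fin.ext (by exact_mod_cast hk.symm)
      exact ⟨h1, fun i => by rw [hk', h2]⟩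
    · rintro ⟨h1, h2⟩
      exact ⟨h1, _, rfl, h2⟩
  rw [h, card_Omega_inter m n S (mem_configs.1 Y.2).1]
  ring

lemma pathCount_eq_mul (n : ℕ) (c a : ℤ) (x : Fin N → ℤ) :
    pathCount n c a x = diffProd x * ((∏ i : Fin N, (((n + i) ! : ℕ) : ℝ)) *
      (∏ i, invFact (a - c * x i)) * ∏ i, invFact (n + N - 1 - a + c * x i)) := by
  rw [pathCount, prod_mul_distrib, prod_mul_distrib]

lemma pathCount_packed (p q : ℕ) :
    pathCount (p + q) 1 (p + N - 1) (packed N 0) = diffProd (packed N 0) *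
      ((∏ i : Fin N, (((p + q + i) ! : ℕ) : ℝ)) * (∏ i : Fin N, (((p + i) ! : ℕ) : ℝ))⁻¹ *
        (∏ i : Fin N, (((q + i) ! : ℕ) : ℝ))⁻¹) := by
  rw [pathCount_eq_mul, ← prod_invFact_natCast_add, ← prod_invFact_natCast_add,
    ← prod_invFact_rev (N := N) p]
  congr 3
  · simp [packed]
  · funext i
    unfold packed
    push_cast
    ring_nf

/-- Here `S = p` and `t = m`. Once the factor common to the packed counts and one Vandermonde
product cancel or match, the factorials `(m + i)!`, `(n + i)!`, `(p + i)!`, `(q + i)!` all enter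
alike. The point weights are reciprocal factorials of `x`, `n - p + x`, `p + N - 1 - x` and `m + N -
1 - x`, and `n - p = q - m`. -/
lemma pathCount_mul_pathCount_comm {m n p q : ℕ} (h : m + n = p + q) (x : Fin N → ℤ) :
    (pathCount (p + q) 1 (p + N - 1) (packed N 0))⁻¹ * pathCount n 1 (p + N - 1) x *
        pathCount m (-1) 0 x =
      (pathCount (m + n) 1 (m + N - 1) (packed N 0))⁻¹ * pathCount q 1 (m + N - 1) x *
        pathCount p (-1) 0 x := by
  rw [pathCount_packed, pathCount_packed]
  simp only [pathCount_eq_mul, h, mul_inv, inv_inv]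
  have e1 : ∀ i, (n : ℤ) + N - 1 - (p + N - 1) + 1 * x i = q + N - 1 - (m + N - 1) + 1 * x i :=
    fun i => by have : (m : ℤ) + n = p + q := by exact_mod_cast h
                linarith
  have e2 : ∀ (k : ℕ) i, (k : ℤ) + N - 1 - 0 + -1 * x i = k + N - 1 - 1 * x i :=
    fun k i => by ring
  simp only [e1, e2]
  ring

/-- This is `rho_eq` with `S` and `t` exchanged. The normalising constant no longer depends on `S`,
so it is shared by the distributions at `S` and `S ± 1`. -/
lemma rho_eq' {T : ℕ} {S t : ℤ} {m p q : ℕ} (ht : t = m) (htT : t ≤ T) (hS : S = p)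
    (hT : (T : ℤ) = p + q) (Y : configs N T S t) :
    rho N T S t Y = (pathCount T 1 (t + N - 1) (packed N 0))⁻¹ * pathCount q 1 (t + N - 1) Y.1 *
      pathCount p (-1) 0 Y.1 := by
  obtain ⟨n, hn⟩ : ∃ n : ℕ, (T : ℤ) = m + n := ⟨(T - t).toNat, by omega⟩
  rw [rho_eq ht hn]
  subst ht hS
  have h := pathCount_mul_pathCount_comm (N := N) (show m + n = p + q by omega) Y.1
  rwa [show m + n = T by omega, show p + q = T by omega] at h

/-! ### The Doob transform. -/

open Classical in
-- Sums over a section become sums over all subsets of moving points, where the recursion applies,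
-- as long as the added terms vanish.
lemma sum_neighbors {c : ℤ} (hc : c ≠ 0) {C : Finset (Fin N → ℤ)} {x : Fin N → ℤ}
    {F : (Fin N → ℤ) → ℝ} (h : ∀ s, F (shift c x s) ≠ 0 → shift c x s ∈ C) :
    ∑ Y : C, (if ∀ i, Y.1 i = x i ∨ Y.1 i = x i + c then F Y.1 else 0) =
      ∑ s, F (shift c x s) := by
  rw [sum_coe_sort C (fun y => if ∀ i, y i = x i ∨ y i = x i + c then F y else 0), ← sum_filter,
    ← sum_image (f := F) (g := shift c x) (s := univ) (shift_injective hc x).injOn]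
  refine sum_subset (fun y hy => ?_) (fun y hy hy' => ?_)
  · obtain ⟨s, rfl⟩ := exists_eq_shift (mem_filter.1 hy).2
    exact mem_image_of_mem _ (mem_univ s)
  · obtain ⟨s, -, rfl⟩ := mem_image.1 hy
    by_contra hne
    exact hy' (mem_filter.2 ⟨h s hne, shift_eq_or c x s⟩)

open Classical in
theorem isStochastic_and_eq_sum {C C' : Finset (Fin N → ℤ)} {c a a' : ℤ} (hc : c * c = 1)
    {m n : ℕ} {K : ℝ} {P : Matrix C C' ℝ} {ρ : C → ℝ} {ρ' : C' → ℝ}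
    (hC : ∀ x ∈ C, StrictMono x ∧ ∀ i, 0 ≤ a - c * x i ∧ 0 ≤ (n + 1 : ℕ) + N - 1 - a + c * x i)
    (hC' : ∀ y ∈ C', StrictMono y)
    (hnext : ∀ x ∈ C, ∀ y, StrictMono y → (∀ i, y i = x i ∨ y i = x i + c) →
      (∀ i, 0 ≤ a - c * y i ∧ 0 ≤ n + N - 1 - a + c * y i) → y ∈ C')
    (hprev : ∀ y ∈ C', ∀ x, StrictMono x → (∀ i, x i = y i ∨ x i = y i + -c) →
      (∀ i, 0 ≤ a' - -c * x i ∧ 0 ≤ m + N - 1 - a' + -c * x i) → x ∈ C)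
    (hP : ∀ X Y, P X Y = if ∀ i, Y.1 i = X.1 i ∨ Y.1 i = X.1 i + c then
      diffProd Y.1 * stepFactor n c a X.1 Y.1 / (poch ((n : ℝ) + 1) N * diffProd X.1) else 0)
    (hρ : ∀ X, ρ X = K * pathCount (n + 1) c a X.1 * pathCount m (-c) a' X.1)
    (hρ' : ∀ Y, ρ' Y = K * pathCount n c a Y.1 * pathCount (m + 1) (-c) a' Y.1) :
    IsStochastic P ∧ ∀ Y, ρ' Y = ∑ X, P X Y * ρ X := by
  have hc0 : c ≠ 0 := by rintro rfl; simp at hc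
  have hpos : ∀ X : C, 0 < pathCount (n + 1) c a X.1 := fun X =>
    pathCount_pos (hC X.1 X.2).1 (hC X.1 X.2).2
  -- The explicit entry is the ratio of path counts, by `pathCount_shift`.
  have hP' : ∀ X Y, P X Y = if ∀ i, Y.1 i = X.1 i ∨ Y.1 i = X.1 i + c then
      pathCount n c a Y.1 / pathCount (n + 1) c a X.1 else 0 := fun X Y => by
    rw [hP]
    split_ifs with h
    · obtain ⟨s, hs⟩ := exists_eq_shift h
      have h1 := diffProd_pos (hC X.1 X.2).1
      have h2 := poch_succ_pos (N := N) n
      rw [div_eq_div_iff (by positivity) (hpos X).ne', ← hs]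
      have h3 := pathCount_shift n hc a X.1 s
      rw [pathCount.eq_1 (n + 1)]
      linear_combination (-diffProd X.1) * h3
    · rfl
  refine ⟨⟨fun X Y => ?_, fun X => ?_⟩, fun Y => ?_⟩
  · rw [hP']
    split_ifs
    · exact div_nonneg (pathCount_nonneg _ _ _ (hC' Y.1 Y.2)) (hpos X).le
    · exact le_rfl
  · simp only [hP']
    rw [sum_neighbors (F := fun y => pathCount n c a y / pathCount (n + 1) c a X.1) hc0 fun s hs => ?_,
      ← sum_div, sum_pathCount_shift n hc, div_self (hpos X).ne']
    have hne : pathCount n c a (shift c X.1 s) ≠ 0 := (div_ne_zero_iff.1 hs).1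
    exact hnext X.1 X.2 _ (strictMono_shift_of_pathCount_ne_zero hc (hC X.1 X.2).1 hne)
      (shift_eq_or _ _ _) (bounds_of_pathCount_ne_zero hne)
  · have hc' : -c * -c = 1 := by rw [neg_mul_neg, hc]
    -- The count `pathCount (n + 1) c a X` cancels, leaving only the backward count to be summed
    -- over predecessors of `Y`.
    have h1 : ∀ X : C, P X Y * ρ X = if ∀ i, X.1 i = Y.1 i ∨ X.1 i = Y.1 i + -c then
        K * pathCount n c a Y.1 * pathCount m (-c) a' X.1 else 0 := fun X => by
      rw [hP', hρ, ite_mul, zero_mul]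
      refine if_congr (forall_congr' fun i => by omega) ?_ rfl
      have := (hpos X).ne'
      field_simp
    simp only [h1]
    by_cases h0 : K * pathCount n c a Y.1 = 0
    · simp [hρ', h0]
    rw [sum_neighbors (F := fun x => K * pathCount n c a Y.1 * pathCount m (-c) a' x)
      (neg_ne_zero.2 hc0) fun s hs => ?_, ← mul_sum, sum_pathCount_shift m hc', hρ']
    have hne : pathCount m (-c) a' (shift (-c) Y.1 s) ≠ 0 := (mul_ne_zero_iff.1 hs).2
    exact hprev Y.1 Y.2 _ (strictMono_shift_of_pathCount_ne_zero hc' (hC' Y.1 Y.2) hne)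
      (shift_eq_or _ _ _) (bounds_of_pathCount_ne_zero hne)

/-! ### The four matrices. -/

lemma stepFactor_one (n : ℕ) (a : ℤ) (x y : Fin N → ℤ) :
    stepFactor n 1 a x y = (∏ i with y i = x i + 1, ((a : ℝ) - x i)) *
      ∏ i with y i = x i, ((n : ℝ) + N - a + x i) := by
  simp [stepFactor]

lemma stepFactor_neg_one (n : ℕ) (x y : Fin N → ℤ) :
    stepFactor n (-1) 0 x y = (∏ i with y i = x i - 1, (x i : ℝ)) *
      ∏ i with y i = x i, ((n : ℝ) + N - x i) := by
  simp [stepFactor, sub_eq_add_neg]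

theorem PtPlus_spec {T : ℕ} {S t : ℤ} (ht : 0 ≤ t) (htT : t < T) :
    IsStochastic (PtPlus N T S t) ∧
      ∀ Y, rho N T S (t + 1) Y = ∑ X, PtPlus N T S t X Y * rho N T S t X := by
  obtain ⟨m, rfl⟩ := Int.eq_ofNat_of_zero_le ht
  obtain ⟨n, hn⟩ : ∃ n : ℕ, (T : ℤ) = m + (n + 1 : ℕ) := ⟨T - m - 1, by omega⟩
  have hnR : (T : ℝ) = m + (n + 1) := by exact_mod_cast hn
  -- The forward target is packed at `S`, with top point `S + N - 1`; the backward target is packed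
  -- at `0`. `K` is the reciprocal of the number of path families.
  refine isStochastic_and_eq_sum (c := 1) (a := S + N - 1) (a' := 0) (m := m) (n := n)
    (K := (pathCount T 1 (S + N - 1) (packed N 0))⁻¹) rfl (fun x hx => ?_)
    (fun y hy => (mem_configs.1 hy).1) (fun x hx y hy h hb => ?_) (fun y hy x hx h hb => ?_)
    (fun X Y => ?_) (fun X => rho_eq rfl hn X)
    (fun Y => rho_eq (m := m + 1) (by push_cast; rfl) (by rw [hn]; push_cast; ring) Y)
  · obtain ⟨h1, h2⟩ := mem_configs.1 hx
    refine ⟨h1, fun i => ?_⟩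
    have := h2 i
    push_cast at *
    omega
  · refine mem_configs.2 ⟨hy, fun i => ?_⟩
    have h1 := (mem_configs.1 hx).2 i
    have h2 := hb i
    have h3 := h i
    push_cast at *
    omega
  · refine mem_configs.2 ⟨hx, fun i => ?_⟩
    have h1 := (mem_configs.1 hy).2 i
    have h2 := hb i
    have h3 := h i
    push_cast at *
    omega
  · rw [PtPlus, Matrix.of_apply, stepFactor_one, hnR]
    refine if_congr (forall_congr' fun i => by omega) ?_ rfl
    push_cast
    rw [mul_assoc]
    refine congrArg₂ (· / ·) (congrArg (_ * ·) (congrArg₂ (· * ·)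
      (prod_congr (by congr!) fun i _ => by ring) (prod_congr (by congr!) fun i _ => by ring)))
      (congrArg (· * _) (congrArg (poch · N) (by ring)))

theorem PSPlus_spec {T : ℕ} {S t : ℤ} (hS : 0 ≤ S) (ht : 0 ≤ t) (htT : t ≤ T) (hST : S < T) :
    IsStochastic (PSPlus N T S t) ∧
      ∀ Y, rho N T (S + 1) t Y = ∑ X, PSPlus N T S t X Y * rho N T S t X := by
  obtain ⟨m, rfl⟩ := Int.eq_ofNat_of_zero_le hS
  obtain ⟨n, hn⟩ : ∃ n : ℕ, (T : ℤ) = m + (n + 1 : ℕ) := ⟨T - m - 1, by omega⟩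
  have hnR : (T : ℝ) = m + (n + 1) := by exact_mod_cast hn
  have ht' : t = t.toNat := by omega
  -- By the symmetry, `S` plays the role of time and `t` that of the terminal height.
  refine isStochastic_and_eq_sum (c := 1) (a := t + N - 1) (a' := 0) (m := m) (n := n)
    (K := (pathCount T 1 (t + N - 1) (packed N 0))⁻¹) rfl (fun x hx => ?_)
    (fun y hy => (mem_configs.1 hy).1) (fun x hx y hy h hb => ?_) (fun y hy x hx h hb => ?_)
    (fun X Y => ?_) (fun X => rho_eq' ht' htT rfl hn X)
    (fun Y => rho_eq' (p := m + 1) ht' htT (by push_cast; rfl) (by rw [hn]; push_cast; ring) Y)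
  · obtain ⟨h1, h2⟩ := mem_configs.1 hx
    refine ⟨h1, fun i => ?_⟩
    have := h2 i
    push_cast at *
    omega
  · refine mem_configs.2 ⟨hy, fun i => ?_⟩
    have h1 := (mem_configs.1 hx).2 i
    have h2 := hb i
    have h3 := h i
    push_cast at *
    omega
  · refine mem_configs.2 ⟨hx, fun i => ?_⟩
    have h1 := (mem_configs.1 hy).2 i
    have h2 := hb i
    have h3 := h i
    push_cast at *
    omega
  · rw [PSPlus, Matrix.of_apply, stepFactor_one, hnR]
    refine if_congr (forall_congr' fun i => by omega) ?_ rfl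
    push_cast
    rw [mul_assoc]
    refine congrArg₂ (· / ·) (congrArg (_ * ·) (congrArg₂ (· * ·)
      (prod_congr (by congr!) fun i _ => by ring) (prod_congr (by congr!) fun i _ => by ring)))
      (congrArg (· * _) (congrArg (poch · N) (by ring)))

theorem PtMinus_spec {T : ℕ} {S t : ℤ} (ht : 0 < t) (htT : t ≤ T) :
    IsStochastic (PtMinus N T S t) ∧
      ∀ Y, rho N T S (t - 1) Y = ∑ X, PtMinus N T S t X Y * rho N T S t X := by
  obtain ⟨n, rfl⟩ : ∃ n : ℕ, t = (n + 1 : ℕ) := ⟨(t - 1).toNat, by omega⟩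
  obtain ⟨m, hm⟩ : ∃ m : ℕ, (T : ℤ) = (n + 1 : ℕ) + m := ⟨T - (n + 1), by omega⟩
  -- Reversed time: the counts towards `0` now define the transform, and those towards the packed
  -- configuration at `S` are the complementary factor.
  refine isStochastic_and_eq_sum (c := -1) (a := 0) (a' := S + N - 1) (m := m) (n := n)
    (K := (pathCount T 1 (S + N - 1) (packed N 0))⁻¹) rfl (fun x hx => ?_)
    (fun y hy => (mem_configs.1 hy).1) (fun x hx y hy h hb => ?_) (fun y hy x hx h hb => ?_)
    (fun X Y => ?_) (fun X => (rho_eq rfl hm X).trans (mul_right_comm _ _ _))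
    (fun Y => (rho_eq (m := n) (n := m + 1) (by push_cast; ring) (by rw [hm]; push_cast; ring)
      Y).trans (mul_right_comm _ _ _))
  · obtain ⟨h1, h2⟩ := mem_configs.1 hx
    refine ⟨h1, fun i => ?_⟩
    have := h2 i
    push_cast at *
    omega
  · refine mem_configs.2 ⟨hy, fun i => ?_⟩
    have h1 := (mem_configs.1 hx).2 i
    have h2 := hb i
    have h3 := h i
    push_cast at *
    omega
  · refine mem_configs.2 ⟨hx, fun i => ?_⟩
    have h1 := (mem_configs.1 hy).2 i
    have h2 := hb i
    have h3 := h i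
    push_cast at *
    omega
  · rw [PtMinus, Matrix.of_apply, stepFactor_neg_one]
    refine if_congr (forall_congr' fun i => by omega) ?_ rfl
    push_cast
    rw [mul_assoc]
    refine congrArg (· / _) (congrArg (_ * ·) (congrArg₂ (· * ·)
      (prod_congr (by congr!) fun _ _ => rfl) (prod_congr (by congr!) fun i _ => by ring)))

theorem PSMinus_spec {T : ℕ} {S t : ℤ} (hS : 0 < S) (hST : S ≤ T) (ht : 0 ≤ t) (htT : t ≤ T) :
    IsStochastic (PSMinus N T S t) ∧
      ∀ Y, rho N T (S - 1) t Y = ∑ X, PSMinus N T S t X Y * rho N T S t X := by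
  obtain ⟨n, rfl⟩ : ∃ n : ℕ, S = (n + 1 : ℕ) := ⟨(S - 1).toNat, by omega⟩
  obtain ⟨m, hm⟩ : ∃ m : ℕ, (T : ℤ) = (n + 1 : ℕ) + m := ⟨T - (n + 1), by omega⟩
  have ht' : t = t.toNat := by omega
  refine isStochastic_and_eq_sum (c := -1) (a := 0) (a' := t + N - 1) (m := m) (n := n)
    (K := (pathCount T 1 (t + N - 1) (packed N 0))⁻¹) rfl (fun x hx => ?_)
    (fun y hy => (mem_configs.1 hy).1) (fun x hx y hy h hb => ?_) (fun y hy x hx h hb => ?_)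
    (fun X Y => ?_) (fun X => (rho_eq' ht' htT rfl hm X).trans (mul_right_comm _ _ _))
    (fun Y => (rho_eq' (p := n) (q := m + 1) ht' htT (by push_cast; ring)
      (by rw [hm]; push_cast; ring) Y).trans (mul_right_comm _ _ _))
  · obtain ⟨h1, h2⟩ := mem_configs.1 hx
    refine ⟨h1, fun i => ?_⟩
    have := h2 i
    push_cast at *
    omega
  · refine mem_configs.2 ⟨hy, fun i => ?_⟩
    have h1 := (mem_configs.1 hx).2 i
    have h2 := hb i
    have h3 := h i
    push_cast at *
    omega
  · refine mem_configs.2 ⟨hx, fun i => ?_⟩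
    have h1 := (mem_configs.1 hy).2 i
    have h2 := hb i
    have h3 := h i
    push_cast at *
    omega
  · rw [PSMinus, Matrix.of_apply, stepFactor_neg_one]
    refine if_congr (forall_congr' fun i => by omega) ?_ rfl
    push_cast
    rw [mul_assoc]
    refine congrArg (· / _) (congrArg (_ * ·) (congrArg₂ (· * ·)
      (prod_congr (by congr!) fun _ _ => rfl) (prod_congr (by congr!) fun i _ => by ring)))

end LozengePaths

end

theorem mainTheorem7 (N T : ℕ) (S t : ℤ) (hS : 0 ≤ S) (hST : S ≤ T) (ht : 0 ≤ t) (htT : t ≤ T) :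
    (t < T →
      LozengePaths.IsStochastic (LozengePaths.PtPlus N T S t) ∧
      ∀ Y, LozengePaths.rho N T S (t + 1) Y =
        ∑ X, LozengePaths.PtPlus N T S t X Y * LozengePaths.rho N T S t X) ∧
    (0 < t →
      LozengePaths.IsStochastic (LozengePaths.PtMinus N T S t) ∧
      ∀ Y, LozengePaths.rho N T S (t - 1) Y =
        ∑ X, LozengePaths.PtMinus N T S t X Y * LozengePaths.rho N T S t X) ∧
    (S < T →
      LozengePaths.IsStochastic (LozengePaths.PSPlus N T S t) ∧
      ∀ Y, LozengePaths.rho N T (S + 1) t Y =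
        ∑ X, LozengePaths.PSPlus N T S t X Y * LozengePaths.rho N T S t X) ∧
    (0 < S →
      LozengePaths.IsStochastic (LozengePaths.PSMinus N T S t) ∧
      ∀ Y, LozengePaths.rho N T (S - 1) t Y =
        ∑ X, LozengePaths.PSMinus N T S t X Y * LozengePaths.rho N T S t X) :=
  ⟨LozengePaths.PtPlus_spec ht, fun h => LozengePaths.PtMinus_spec h htT,
    LozengePaths.PSPlus_spec hS ht htT, fun h => LozengePaths.PSMinus_spec h hST ht htT⟩
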